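/- Let $R$ be a commutative ring with unity and let $k \in \mathbb{N}$. Definitions. A finite family $a_1,\dots,a_n$ of elements of $R$ is *unital* if it generates the unit ideal. A proper ideal $\mathcal{I} \subsetneq R$ satisfies the *unital set condition* (USC) if for every unital family $a_1,\dots,a_n$ with $n \ge 2$ (repetitions allowed) there is $b \in \langle a_2,\dots,a_n\rangle$ such that $a_1+b$ is a unit modulo $\mathcal{I}$. For an ideal $\mathcal{I} \subseteq R$ and $m=(m_1,\dots,m_{2k}) \in \mathbb{N}^{2k}$, let $\mathbb{PF}^{2k-1,m}_{\mathcal{I}}$ be the set of unital vectors $(a_1,\dots,a_{2k}) \in R^{2k}$ modulo the equivalence relation $(a_j)_j \sim (b_j)_j$ iff there is $\lambda \in R$, a unit modulo $\mathcal{I}$, with $a_j \equiv \lambda^{m_j} b_j \bmod \mathcal{I}$ for all $j$ (for $\mathcal{I}=R$ any two unital vectors are related); the class of $(a_j)_j$ is written $[a_1:\dots:a_{2k}]$. Let $SP_{2k}(R)$ be the group of symplectic $2k\times 2k$ matrices over $R$. For an ideal $\mathcal{J} \subseteq R$ let $\Gamma_k(\mathcal{J})$ be the kernel of the reduction homomorphism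 $SP_{2k}(R)\to SP_{2k}(R/\mathcal{J})$. A subgroup of $SP_{2k}(R)$ is a *congruence ideal subgroup* if it contains $\Gamma_k(\mathcal{J})$ for some ideal $\mathcal{J} \subseteq R$. Theorem. Let $\mathcal{I}_1,\dots,\mathcal{I}_{2k}$ be mutually co-maximal ideals of $R$ (that is, $\mathcal{I}_i+\mathcal{I}_j=R$ for $i\neq j$) such that the product $\mathcal{I}=\prod_{i=1}^{2k}\mathcal{I}_i$ satisfies the USC or $\mathcal{I}=R$. Let $m^i_j \in \mathbb{N}$ for $1 \le i,j \le 2k$, put $m^i = (m^i_1,\dots,m^i_{2k})$, and let $\Gamma \subseteq SP_{2k}(R)$ be a congruence ideal subgroup. If $\Gamma\,\Gamma_k(\mathcal{I})=SP_{2k}(R)$, then the map $$\Gamma \longrightarrow \prod_{i=1}^{2k}\mathbb{PF}^{2k-1,m^i}_{\mathcal{I}_i},\qquad A=[a_{i,j}]_{1\le i,j\le 2k}\longmapsto \big([a_{i,1}:a_{i,2}:\dots:a_{i,2k}]\big)_{1\le i\le 2k},$$ is surjective. In particular, if $\Gamma \supseteq \Gamma_k(\mathcal{J})$ for some ideal $\mathcal{J}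 \subseteq R$ such that $\mathcal{J}+\mathcal{I}=R$ and either $\mathcal{I}\mathcal{J}$ satisfies the USC or $\mathcal{I}\mathcal{J}=R$, then this map is surjective. -/

import Mathlib

open scoped Pointwise

namespace CongruenceRows

section ProjectiveSpaces

variable {ι R : Type*} [CommRing R]

/-- A family of elements of `R` is unital if it generates the unit ideal. -/
def IsUnital (a : ι → R) : Prop :=
  Ideal.span (Set.range a) = ⊤

/-- The unital set condition for a proper ideal `I`: for every unital finite family
`a 0, a 1, …, a (n + 1)` (at least two elements, repetitions allowed) there is an element `b` of
the ideal generated by `a 1, …, a (n + 1)` such that `a 0 + b` is a unit modulo `I`. -/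
def USC (I : Ideal R) : Prop :=
  I ≠ ⊤ ∧ ∀ (n : ℕ) (a : Fin (n + 2) → R), IsUnital a →
    ∃ b ∈ Ideal.span (Set.range fun i : Fin (n + 1) => a i.succ),
      IsUnit (Ideal.Quotient.mk I (a 0 + b))

variable (ι R) in
/-- The unital vectors with coordinates indexed by `ι`. -/
def GCD : Type _ :=
  {a : ι → R // IsUnital a}

/-- `a ∼ b` if there is `c` in `R`, a unit modulo `I`, with `a j ≡ c ^ m j * b j` modulo `I`
for all `j`. -/
def ProjRel (I : Ideal R) (m : ι → ℕ) (a b : GCD ι R) : Prop :=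
  ∃ c : R, IsUnit (Ideal.Quotient.mk I c) ∧
    ∀ j, Ideal.Quotient.mk I (a.1 j) = Ideal.Quotient.mk I (c ^ m j * b.1 j)

theorem projRel_equivalence (I : Ideal R) (m : ι → ℕ) :
    Equivalence (ProjRel (ι := ι) I m) where
  refl a := ⟨1, by simp, by simp⟩
  symm := by
    rintro a b ⟨c, hc, h⟩
    obtain ⟨d, hd⟩ := isUnit_iff_exists_inv.mp hc
    obtain ⟨d, rfl⟩ := Ideal.Quotient.mk_surjective d
    refine ⟨d, isUnit_iff_exists_inv.mpr ⟨_, (mul_comm _ _).trans hd⟩, fun j => ?_⟩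
    rw [map_mul, h j, map_mul, ← mul_assoc, ← map_mul, ← mul_pow, map_pow, mul_comm d c, map_mul,
      hd, one_pow, one_mul]
  trans := by
    rintro x y z ⟨c, hc, h⟩ ⟨d, hd, h'⟩
    refine ⟨c * d, by rw [map_mul]; exact hc.mul hd, fun j => ?_⟩
    rw [h j, map_mul, h' j, ← map_mul, mul_pow, mul_assoc]

/-- If `I` is the whole ring then any two unital vectors are related. -/
theorem projRel_top (m : ι → ℕ) (a b : GCD ι R) : ProjRel ⊤ m a b :=
  ⟨1, by simp, fun j => (Ideal.Quotient.mk_eq_mk_iff_sub_mem _ _).mpr trivial⟩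

/-- The relation `∼` as a setoid on the unital vectors. -/
def projSetoid (I : Ideal R) (m : ι → ℕ) : Setoid (GCD ι R) :=
  ⟨ProjRel I m, projRel_equivalence I m⟩

/-- The generalized projective space with weights `m` attached to the ideal `I`: the unital
vectors modulo `∼`. For `I = ⊤` all unital vectors are identified (see `projRel_top`). -/
def PF (I : Ideal R) (m : ι → ℕ) : Type _ :=
  Quotient (projSetoid I m)

/-- The class `[a_1 : a_2 : …]` of a unital vector. -/
def PF.mk (I : Ideal R) (m : ι → ℕ) (a : GCD ι R) : PF I m :=
  Quotient.mk (projSetoid I m) a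

end ProjectiveSpaces

section Symplectic

variable {l R S : Type*} [DecidableEq l] [Fintype l] [CommRing R] [CommRing S]

/-- Applying a ring homomorphism to the entries of symplectic matrices. -/
def symplecticMap (f : R →+* S) :
    Matrix.symplecticGroup l R →* Matrix.symplecticGroup l S where
  toFun A := ⟨A.1.map f, by
    have h := congrArg (fun M => M.map f) (SymplecticGroup.mem_iff.mp A.2)
    simp only [Matrix.map_mul, Matrix.map_J, Matrix.transpose_map] at h
    exact SymplecticGroup.mem_iff.mpr h⟩
  map_one' := Subtype.ext (by simp)
  map_mul' A B := Subtype.ext (by simp [Matrix.map_mul])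

/-- The principal congruence ideal subgroup of `J`: the kernel of reduction modulo `J`. -/
def principalCongruence (l : Type*) [DecidableEq l] [Fintype l] (J : Ideal R) :
    Subgroup (Matrix.symplecticGroup l R) :=
  (symplecticMap (l := l) (Ideal.Quotient.mk J)).ker

/-- A congruence ideal subgroup contains some principal congruence ideal subgroup. -/
def IsCongruenceIdealSubgroup (Γ : Subgroup (Matrix.symplecticGroup l R)) : Prop :=
  ∃ J : Ideal R, principalCongruence l J ≤ Γ

theorem isUnital_row (A : Matrix.symplecticGroup l R) (i : l ⊕ l) : IsUnital (A.1 i) := by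
  have h : A.1 * (A⁻¹).1 = 1 := congrArg Subtype.val (mul_inv_cancel A)
  have h1 := congrFun (congrFun h i) i
  rw [Matrix.mul_apply, Matrix.one_apply_eq] at h1
  refine (Ideal.eq_top_iff_one _).mpr ?_
  rw [← h1]
  exact Ideal.sum_mem _ fun j _ => Ideal.mul_mem_right _ _ (Ideal.subset_span ⟨j, rfl⟩)

/-- The map sending a matrix in `Γ` to the tuple of the classes of its rows, the class of the
`i`-th row being taken with respect to the ideal `I i` and the weights `m i`. -/
def rowMap (Γ : Subgroup (Matrix.symplecticGroup l R)) (I : l ⊕ l → Ideal R)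
    (m : l ⊕ l → l ⊕ l → ℕ) (A : Γ) : ∀ i, PF (I i) (m i) :=
  fun i => PF.mk (I i) (m i) ⟨A.1.1 i, isUnital_row A.1 i⟩

end Symplectic

end CongruenceRows

/-! The USC for the product gives stable range one in its quotient, hence in every `R ⧸ I i`. Over
such a ring, unipotent symplectic matrices carry any unital row to a fixed basis vector
(`StableRangeOne.exists_vecMul_eq_single`), so every unital vector is a prescribed row of a product
of unipotents. General symplectic matrices need not lift along a quotient, but unipotents do, since
only a symmetric matrix has to be lifted; by comaximality the lift can be trivial modulo the other
ideals. Rows with respect to different `I i` are thus adjusted independently, and the product of the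
adjusting matrices has all the required rows at once. -/

namespace CongruenceRows

open Matrix

/-! ### Stable range one and shortening of unital vectors. -/

section StableRange

/-- Stable range one: every coprime pair `x, y` can be shortened to a unit `x + c * y`. -/
def StableRangeOne (T : Type*) [CommRing T] : Prop :=
  ∀ x y : T, IsCoprime x y → ∃ c, IsUnit (x + c * y)

/-- The relation `u * x + v * y = 1` holds only modulo `I`, so the USC is applied to `x, 1 - u * x`,
which is unital in `R` itself; modulo `I` the second entry is `v * y`. -/
theorem USC.stableRangeOne {R : Type*} [CommRing R] {I : Ideal R} (h : USC I) :
    StableRangeOne (R ⧸ I) := by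
  rintro x y ⟨u, v, huv⟩
  obtain ⟨x, rfl⟩ := Ideal.Quotient.mk_surjective x
  obtain ⟨y, rfl⟩ := Ideal.Quotient.mk_surjective y
  obtain ⟨u, rfl⟩ := Ideal.Quotient.mk_surjective u
  obtain ⟨v, rfl⟩ := Ideal.Quotient.mk_surjective v
  obtain ⟨b, hb, hunit⟩ := h.2 0 ![x, 1 - u * x] <| by
    refine (Ideal.eq_top_iff_one _).mpr ?_
    have h0 : x ∈ Ideal.span (Set.range ![x, 1 - u * x]) := Ideal.subset_span ⟨0, rfl⟩
    have h1 : 1 - u * x ∈ Ideal.span (Set.range ![x, 1 - u * x]) := Ideal.subset_span ⟨1, rfl⟩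
    simpa using Ideal.add_mem _ h1 (Ideal.mul_mem_left _ u h0)
  have hrange : (Set.range fun i : Fin (0 + 1) => ![x, 1 - u * x] i.succ) = {1 - u * x} :=
    Set.range_unique (ι := Fin 1)
  rw [hrange, Ideal.mem_span_singleton'] at hb
  obtain ⟨r, rfl⟩ := hb
  refine ⟨Ideal.Quotient.mk I (r * v), ?_⟩
  have : Ideal.Quotient.mk I (1 - u * x) = Ideal.Quotient.mk I (v * y) := by
    rw [map_sub, map_one, ← huv, map_mul, map_mul]; ring
  convert hunit using 1
  rw [cons_val_zero]
  rw [map_add, map_mul _ r (1 - u * x), this]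
  simp only [map_mul]
  ring

theorem StableRangeOne.of_surjective {S T : Type*} [CommRing S] [CommRing T]
    (hS : StableRangeOne S) (f : S →+* T) (hf : Function.Surjective f) : StableRangeOne T := by
  rintro x y ⟨u, v, huv⟩
  obtain ⟨x, rfl⟩ := hf x
  obtain ⟨y, rfl⟩ := hf y
  obtain ⟨u, rfl⟩ := hf u
  obtain ⟨v, rfl⟩ := hf v
  obtain ⟨c, hc⟩ := hS x (1 - u * x) ⟨u, 1, by ring⟩
  refine ⟨f c * f v, ?_⟩
  have h := hc.map f
  have : f (1 - u * x) = f v * f y := by rw [map_sub, map_one, ← huv, map_mul]; ring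
  rwa [map_add, map_mul, this, ← mul_assoc] at h

variable {T : Type*} [CommRing T]

theorem StableRangeOne.exists_sup_span_eq_top (hT : StableRangeOne T) {N : Ideal T} {x y : T}
    (h : N ⊔ Ideal.span {x, y} = ⊤) : ∃ c, N ⊔ Ideal.span {x + c * y} = ⊤ := by
  obtain ⟨n, hn, z, hz, hnz⟩ := Submodule.mem_sup.mp ((Ideal.eq_top_iff_one _).mp h)
  obtain ⟨p, q, rfl⟩ := Ideal.mem_span_pair.mp hz
  -- Absorbing `n` into the second entry makes the pair coprime in `T`; the multiple of `n` then
  -- goes back into `N`.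
  obtain ⟨c, hc⟩ := hT x (q * y + n) ⟨p, 1, by linear_combination hnz⟩
  refine ⟨c * q, Ideal.eq_top_of_isUnit_mem _ ?_ hc⟩
  have : x + c * (q * y + n) = c * n + (x + c * q * y) := by ring
  rw [this]
  exact Submodule.add_mem_sup (Ideal.mul_mem_left _ _ hn) (Ideal.mem_span_singleton_self _)

variable {l : Type*} [Fintype l]

/-- If `(a, b)` is unital then some `b + t a`, with `t` diagonal, is unital. -/
theorem StableRangeOne.exists_isUnital_add_mul [DecidableEq l] (hT : StableRangeOne T) {a b : l → T}
    (h : IsUnital (Sum.elim a b)) : ∃ t : l → T, IsUnital (b + t * a) := by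
  -- Entries of `a` are discarded one at a time: those indexed by `s` are no longer needed as
  -- generators.
  suffices H : ∀ s : Finset l, ∃ t : l → T,
      Ideal.span (Set.range (b + t * a) ∪ a '' (↑s)ᶜ) = ⊤ by
    obtain ⟨t, ht⟩ := H Finset.univ
    exact ⟨t, by simpa [IsUnital] using ht⟩
  intro s
  induction s using Finset.induction_on with
  | empty =>
    refine ⟨0, ?_⟩
    rw [IsUnital, Set.Sum.elim_range] at h
    simpa [Set.union_comm] using h
  | insert i s hi ih =>
    obtain ⟨t, ht⟩ := ih
    set N := Ideal.span ((b + t * a) '' {i}ᶜ ∪ a '' (↑(insert i s))ᶜ) with hN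
    obtain ⟨c, hc⟩ := hT.exists_sup_span_eq_top (N := N) (x := (b + t * a) i) (y := a i) <| by
      rw [eq_top_iff, ← ht, Ideal.span_le]
      rintro _ (⟨j, rfl⟩ | ⟨j, hj, rfl⟩)
      · by_cases hji : j = i
        · subst hji
          exact Ideal.mem_sup_right (Ideal.subset_span (by simp))
        · exact Ideal.mem_sup_left (Ideal.subset_span (Or.inl ⟨j, hji, rfl⟩))
      · by_cases hji : j = i
        · subst hji
          exact Ideal.mem_sup_right (Ideal.subset_span (by simp))
        · exact Ideal.mem_sup_left (Ideal.subset_span (Or.inr ⟨j, by simpa [hji] using hj, rfl⟩))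
    refine ⟨t + Pi.single i c, ?_⟩
    rw [eq_top_iff, ← hc, sup_le_iff, Ideal.span_le, Ideal.span_le]
    constructor
    · rintro _ (⟨j, hj, rfl⟩ | ⟨j, hj, rfl⟩)
      · have hji : j ≠ i := hj
        exact Ideal.subset_span (Or.inl ⟨j, by simp [hji]⟩)
      · exact Ideal.subset_span (Or.inr ⟨j, hj, rfl⟩)
    · rintro _ rfl
      exact Ideal.subset_span (Or.inl ⟨i, by simp; ring⟩)

theorem StableRangeOne.exists_isUnit_add_dotProduct (hT : StableRangeOne T) {b : l → T}
    (hb : IsUnital b) (x : T) : ∃ c : l → T, IsUnit (x + b ⬝ᵥ c) := by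
  obtain ⟨d, hd⟩ := (Ideal.mem_span_range_iff_exists_fun).mp ((Ideal.eq_top_iff_one _).mp hb)
  obtain ⟨c, hc⟩ := hT x 1 isCoprime_one_right
  refine ⟨c • d, ?_⟩
  rwa [dotProduct_smul, dotProduct_comm, dotProduct, hd]

end StableRange

/-! ### Unipotent symplectic matrices acting on rows. -/

section Unipotent

variable {l R S : Type*} [DecidableEq l] [CommRing R] [CommRing S]

theorem isUnital_single (i : l) : IsUnital (Pi.single i 1 : l → R) :=
  Ideal.eq_top_of_isUnit_mem _ (Ideal.subset_span ⟨i, Pi.single_eq_same i 1⟩) isUnit_one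

/-- The symmetric matrix whose row and column at `i` are `c`, with all other entries zero. -/
def crossMatrix (i : l) (c : l → R) : Matrix l l R :=
  of fun p q => if q = i then c p else if p = i then c q else 0

theorem crossMatrix_isSymm (i : l) (c : l → R) : (crossMatrix i c).IsSymm := by
  ext p q
  by_cases hp : p = i <;> by_cases hq : q = i <;> simp [crossMatrix, hp, hq]

variable [Fintype l]

theorem vecMul_crossMatrix_self (i : l) (a c : l → R) : (a ᵥ* crossMatrix i c) i = a ⬝ᵥ c := by
  simp [vecMul, crossMatrix, dotProduct]

theorem vecMul_crossMatrix_of_ne {i j : l} (hj : j ≠ i) (a c : l → R) :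
    (a ᵥ* crossMatrix i c) j = a i * c j := by
  simp [vecMul, crossMatrix, dotProduct, hj]

theorem exists_isSymm_vecMul_eq {a : l → R} {i : l} (ha : IsUnit (a i)) (w : l → R) :
    ∃ B : Matrix l l R, B.IsSymm ∧ a ᵥ* B = w := by
  obtain ⟨u, hu⟩ := isUnit_iff_exists_inv.mp ha
  -- Off `i` the equation reads `a i * c j = w j`; the coordinate `i` is then linear in `c i` with
  -- unit coefficient `a i`.
  set c : l → R := Function.update (u • w) i (u * (w i - ∑ j ∈ Finset.univ.erase i, a j * (u * w j)))
    with hc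
  refine ⟨crossMatrix i c, crossMatrix_isSymm i c, funext fun j => ?_⟩
  by_cases hj : j = i
  · subst hj
    rw [vecMul_crossMatrix_self, dotProduct, ← Finset.add_sum_erase _ _ (Finset.mem_univ j)]
    have : ∀ p ∈ Finset.univ.erase j, a p * c p = a p * (u * w p) := fun p hp => by
      simp [hc, Finset.ne_of_mem_erase hp]
    rw [Finset.sum_congr rfl this]
    simp only [hc, Function.update_self]
    rw [← mul_assoc, hu]
    ring
  · rw [vecMul_crossMatrix_of_ne hj]
    simp only [hc, ne_eq, hj, not_false_eq_true, Function.update_of_ne, Pi.smul_apply, smul_eq_mul]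
    rw [← mul_assoc, hu, one_mul]

/-- The upper unipotent symplectic matrix attached to a symmetric matrix. -/
def upperUnipotent (B : Matrix l l R) (hB : B.IsSymm) : symplecticGroup l R :=
  ⟨fromBlocks 1 B 0 1, SymplecticGroup.mem_iff.mpr <| by
    simp [J, fromBlocks_transpose, fromBlocks_multiply, hB.eq]⟩

/-- The lower unipotent symplectic matrix attached to a symmetric matrix. -/
def lowerUnipotent (B : Matrix l l R) (hB : B.IsSymm) : symplecticGroup l R :=
  ⟨fromBlocks 1 0 B 1, SymplecticGroup.mem_iff.mpr <| by
    simp [J, fromBlocks_transpose, fromBlocks_multiply, hB.eq]⟩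

theorem vecMul_upperUnipotent (a b : l → R) (B : Matrix l l R) (hB : B.IsSymm) :
    Sum.elim a b ᵥ* (upperUnipotent B hB).1 = Sum.elim a (a ᵥ* B + b) := by
  simp [upperUnipotent, vecMul_fromBlocks]

theorem vecMul_lowerUnipotent (a b : l → R) (B : Matrix l l R) (hB : B.IsSymm) :
    Sum.elim a b ᵥ* (lowerUnipotent B hB).1 = Sum.elim (a + b ᵥ* B) b := by
  simp [lowerUnipotent, vecMul_fromBlocks]

theorem symplecticMap_upperUnipotent (f : R →+* S) (B : Matrix l l R) (hB : B.IsSymm) :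
    symplecticMap f (upperUnipotent B hB) = upperUnipotent (B.map f) (hB.map f) :=
  Subtype.ext <| by
    simp [symplecticMap, upperUnipotent, fromBlocks_map]

theorem symplecticMap_lowerUnipotent (f : R →+* S) (B : Matrix l l R) (hB : B.IsSymm) :
    symplecticMap f (lowerUnipotent B hB) = lowerUnipotent (B.map f) (hB.map f) :=
  Subtype.ext <| by
    simp [symplecticMap, lowerUnipotent, fromBlocks_map]

/-- A group containing all unipotents moves every unital row to one basis vector. -/
theorem StableRangeOne.exists_vecMul_eq_single (hR : StableRangeOne R)
    {H : Subgroup (symplecticGroup l R)}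
    (hup : ∀ B hB, upperUnipotent B hB ∈ H) (hlow : ∀ B hB, lowerUnipotent B hB ∈ H) (i : l)
    {v : l ⊕ l → R} (hv : IsUnital v) :
    ∃ A ∈ H, v ᵥ* A.1 = Sum.elim (0 : l → R) (Pi.single i 1) := by
  obtain ⟨a, b, rfl⟩ : ∃ a b, v = Sum.elim a b := ⟨_, _, (Sum.elim_comp_inl_inr v).symm⟩
  -- Four moves: make the second half unital, make entry `i` of the first half a unit, use it to
  -- turn the second half into the basis vector, and use that to clear the first half.
  obtain ⟨t, ht⟩ := hR.exists_isUnital_add_mul hv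
  obtain ⟨c, hc⟩ := hR.exists_isUnit_add_dotProduct ht (a i)
  set b' := b + t * a with hb'
  set a' := a + b' ᵥ* crossMatrix i c with ha'
  obtain ⟨B, hB, hBeq⟩ := exists_isSymm_vecMul_eq (a := a') (i := i)
    (by rwa [ha', Pi.add_apply, vecMul_crossMatrix_self]) (Pi.single i 1 - b')
  obtain ⟨C, hC, hCeq⟩ := exists_isSymm_vecMul_eq (a := (Pi.single i 1 : l → R)) (i := i)
    (by simp) (-a')
  refine ⟨upperUnipotent (diagonal t) (isSymm_diagonal t) *
    lowerUnipotent (crossMatrix i c) (crossMatrix_isSymm i c) *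
    upperUnipotent B hB * lowerUnipotent C hC,
    mul_mem (mul_mem (mul_mem (hup _ _) (hlow _ _)) (hup _ _)) (hlow _ _), ?_⟩
  have hdiag : a ᵥ* diagonal t + b = b' := by
    ext j
    simp [hb', vecMul_diagonal]
    ring
  simp only [Submonoid.coe_mul, ← vecMul_vecMul]
  rw [vecMul_upperUnipotent, hdiag, vecMul_lowerUnipotent, ← ha', vecMul_upperUnipotent, hBeq,
    sub_add_cancel, vecMul_lowerUnipotent, hCeq, add_neg_cancel]

/-- A group containing all unipotents realizes every unital vector as a given row. -/
theorem StableRangeOne.exists_row_eq (hR : StableRangeOne R)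
    {H : Subgroup (symplecticGroup l R)}
    (hup : ∀ B hB, upperUnipotent B hB ∈ H) (hlow : ∀ B hB, lowerUnipotent B hB ∈ H)
    (i : l ⊕ l) {v : l ⊕ l → R} (hv : IsUnital v) :
    ∃ A ∈ H, A.1 i = v := by
  -- Both `v` and the basis vector at `i` are moved to the same target, whichever half contains `i`.
  obtain ⟨A, hA, hAv⟩ := hR.exists_vecMul_eq_single hup hlow (i.elim id id) hv
  obtain ⟨E, hE, hEv⟩ := hR.exists_vecMul_eq_single hup hlow (i.elim id id)
    (isUnital_single (R := R) i)
  refine ⟨E * A⁻¹, mul_mem hE (inv_mem hA), ?_⟩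
  have h1 : A.1 * (A⁻¹).1 = 1 := congrArg Subtype.val (mul_inv_cancel A)
  rw [← hAv] at hEv
  have h2 := congrArg (fun w => w ᵥ* (A⁻¹).1) hEv
  simp only [vecMul_vecMul, h1, vecMul_one] at h2
  rw [← h2, single_one_vecMul]
  rfl

end Unipotent

/-! ### Lifting to congruence subgroups and gluing the rows. -/

section Congruence

variable {l R : Type*} [CommRing R]

/-- Comaximality gives a set-theoretic section of `R → R ⧸ I` with values in `I'`; applied
entrywise, it preserves symmetry. -/
theorem exists_isSymm_lift {I I' : Ideal R} (h : I' ⊔ I = ⊤) {B : Matrix l l (R ⧸ I)}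
    (hB : B.IsSymm) :
    ∃ C : Matrix l l R, C.IsSymm ∧ C.map (Ideal.Quotient.mk I) = B ∧
      C.map (Ideal.Quotient.mk I') = 0 := by
  have hs : ∀ x : R ⧸ I, ∃ y ∈ I', Ideal.Quotient.mk I y = x := fun x => by
    obtain ⟨x, rfl⟩ := Ideal.Quotient.mk_surjective x
    obtain ⟨y, hy, z, hz, rfl⟩ := Submodule.mem_sup.mp (h ▸ Submodule.mem_top : x ∈ I' ⊔ I)
    exact ⟨y, hy, by rw [map_add, Ideal.Quotient.eq_zero_iff_mem.mpr hz, add_zero]⟩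
  choose s hs hsB using hs
  refine ⟨B.map s, hB.map s, ?_, ?_⟩
  · ext p q
    exact hsB _
  · ext p q
    exact Ideal.Quotient.eq_zero_iff_mem.mpr (hs _)

variable [DecidableEq l] [Fintype l]

theorem symplecticMap_mk_eq_iff (I : Ideal R) (A B : symplecticGroup l R) :
    symplecticMap (Ideal.Quotient.mk I) A = symplecticMap (Ideal.Quotient.mk I) B ↔
      ∀ p q, A.1 p q - B.1 p q ∈ I := by
  simp only [← Ideal.Quotient.mk_eq_mk_iff_sub_mem]
  rw [Subtype.ext_iff, ← Matrix.ext_iff]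
  rfl

theorem mem_principalCongruence {I : Ideal R} {A : symplecticGroup l R} :
    A ∈ principalCongruence l I ↔ symplecticMap (Ideal.Quotient.mk I) A = 1 :=
  Iff.rfl

theorem principalCongruence_mono {I I' : Ideal R} (h : I ≤ I') :
    principalCongruence l I ≤ principalCongruence l I' := fun A hA => by
  rw [mem_principalCongruence, ← map_one (symplecticMap (Ideal.Quotient.mk _)),
    symplecticMap_mk_eq_iff] at hA ⊢
  exact fun p q => h (hA p q)

/-- The image of the congruence subgroup of `I'` modulo `I` contains all unipotents, so
`StableRangeOne.exists_row_eq` applies to it. -/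
theorem exists_mem_principalCongruence_row {I I' : Ideal R} (h : I' ⊔ I = ⊤)
    (hI : StableRangeOne (R ⧸ I)) (i : l ⊕ l) {v : l ⊕ l → R} (hv : IsUnital v) :
    ∃ A ∈ principalCongruence l I', ∀ j, A.1 i j - v j ∈ I := by
  obtain ⟨_, ⟨A, hA, rfl⟩, hAv⟩ := hI.exists_row_eq
    (H := (principalCongruence l I').map (symplecticMap (Ideal.Quotient.mk I)))
    (fun B hB => by
      obtain ⟨C, hC, rfl, hC'⟩ := exists_isSymm_lift h hB
      refine ⟨upperUnipotent C hC, ?_, symplecticMap_upperUnipotent _ _ _⟩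
      rw [SetLike.mem_coe, mem_principalCongruence, symplecticMap_upperUnipotent]
      exact Subtype.ext (by simp [upperUnipotent, hC']))
    (fun B hB => by
      obtain ⟨C, hC, rfl, hC'⟩ := exists_isSymm_lift h hB
      refine ⟨lowerUnipotent C hC, ?_, symplecticMap_lowerUnipotent _ _ _⟩
      rw [SetLike.mem_coe, mem_principalCongruence, symplecticMap_lowerUnipotent]
      exact Subtype.ext (by simp [lowerUnipotent, hC']))
    i (v := Ideal.Quotient.mk I ∘ v) (by
      rw [IsUnital, Set.range_comp, ← Ideal.map_span, show Ideal.span (Set.range v) = ⊤ from hv,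
        Ideal.map_top])
  exact ⟨A, hA, fun j => (Ideal.Quotient.mk_eq_mk_iff_sub_mem _ _).mp (congrFun hAv j)⟩

/-- Simultaneous approximation by symplectic matrices that are trivial modulo the other ideals. -/
theorem exists_symplecticMap_eq {ι : Type*} [Fintype ι] [DecidableEq ι] (I : ι → Ideal R)
    (H : Subgroup (symplecticGroup l R)) (A : ι → symplecticGroup l R) (hA : ∀ i, A i ∈ H)
    (hA' : ∀ i j, i ≠ j → A i ∈ principalCongruence l (I j)) :
    ∃ B ∈ H, ∀ i, symplecticMap (Ideal.Quotient.mk (I i)) B =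
      symplecticMap (Ideal.Quotient.mk (I i)) (A i) := by
  suffices H : ∀ s : Finset ι, ∃ B ∈ H, ∀ i, symplecticMap (Ideal.Quotient.mk (I i)) B =
      if i ∈ s then symplecticMap (Ideal.Quotient.mk (I i)) (A i) else 1 by
    simpa using H Finset.univ
  intro s
  induction s using Finset.induction_on with
  | empty => exact ⟨1, one_mem _, by simp⟩
  | insert j s hj ih =>
    obtain ⟨B, hB, hBs⟩ := ih
    refine ⟨B * A j, mul_mem hB (hA j), fun i => ?_⟩
    rw [map_mul, hBs]
    by_cases hij : i = j
    · subst hij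
      simp [hj]
    · rw [mem_principalCongruence.mp (hA' j i (Ne.symm hij))]
      simp [hij]

theorem inf_iInf_erase_sup_eq_top {ι : Type*} [Fintype ι] [DecidableEq ι] {I : ι → Ideal R}
    (hcomax : ∀ i j, i ≠ j → I i ⊔ I j = ⊤) {I' : Ideal R} (hI' : I' ⊔ ∏ i, I i = ⊤) (i : ι) :
    (I' ⊓ ⨅ j ∈ Finset.univ.erase i, I j) ⊔ I i = ⊤ := by
  have h1 : I i ⊔ I' = ⊤ := eq_top_iff.mpr <| by
    rw [← hI', sup_comm]
    exact sup_le_sup_right (Ideal.prod_le_inf.trans (Finset.inf_le (Finset.mem_univ i))) _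
  have h2 : I i ⊔ ⨅ j ∈ Finset.univ.erase i, I j = ⊤ :=
    Ideal.sup_iInf_eq_top fun j hj => hcomax i j (Finset.ne_of_mem_erase hj).symm
  rw [← Ideal.isCoprime_iff_sup_eq] at h1 h2
  rw [sup_comm, eq_top_iff, ← (h1.mul_right h2).sup_eq]
  exact sup_le_sup_left Ideal.mul_le_inf _

theorem exists_mem_principalCongruence_rows {I : l ⊕ l → Ideal R}
    (hcomax : ∀ i j, i ≠ j → I i ⊔ I j = ⊤) (hI : ∀ i, StableRangeOne (R ⧸ I i))
    {I' : Ideal R} (hI' : I' ⊔ ∏ i, I i = ⊤) {v : l ⊕ l → l ⊕ l → R} (hv : ∀ i, IsUnital (v i)) :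
    ∃ A ∈ principalCongruence l I', ∀ i j, A.1 i j - v i j ∈ I i := by
  have hrow := fun i => exists_mem_principalCongruence_row
    (inf_iInf_erase_sup_eq_top hcomax hI' i) (hI i) i (hv i)
  choose A hA hAv using hrow
  have hle : ∀ i j, i ≠ j → I' ⊓ ⨅ p ∈ Finset.univ.erase i, I p ≤ I j := fun i j hij =>
    inf_le_right.trans (iInf₂_le j (Finset.mem_erase.mpr ⟨hij.symm, Finset.mem_univ j⟩))
  obtain ⟨B, hB, hBA⟩ := exists_symplecticMap_eq I (principalCongruence l I') A
    (fun i => principalCongruence_mono inf_le_left (hA i))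
    (fun i j hij => principalCongruence_mono (hle i j hij) (hA i))
  refine ⟨B, hB, fun i j => ?_⟩
  have h := (symplecticMap_mk_eq_iff _ _ _).mp (hBA i) i j
  rw [← sub_add_sub_cancel _ ((A i).1 i j)]
  exact Ideal.add_mem _ h (hAv i j)

/-- Congruent rows are equivalent with scalar `1`, whatever the weights. -/
theorem rowMap_surjective_of_forall_exists {Γ : Subgroup (symplecticGroup l R)}
    {I : l ⊕ l → Ideal R} (m : l ⊕ l → l ⊕ l → ℕ)
    (h : ∀ v : l ⊕ l → l ⊕ l → R, (∀ i, IsUnital (v i)) → ∃ A ∈ Γ, ∀ i j, A.1 i j - v i j ∈ I i) :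
    Function.Surjective (rowMap Γ I m) := by
  intro w
  choose v hv using fun i => Quotient.exists_rep (w i)
  obtain ⟨A, hA, hAv⟩ := h (fun i => (v i).1) fun i => (v i).2
  refine ⟨⟨A, hA⟩, funext fun i => ?_⟩
  rw [← hv i]
  refine Quotient.sound ⟨1, by simp, fun j => ?_⟩
  rw [one_pow, one_mul]
  exact (Ideal.Quotient.mk_eq_mk_iff_sub_mem _ _).mpr (hAv i j)

theorem stableRangeOne_of_usc_prod {ι : Type*} [Fintype ι] {I : ι → Ideal R}
    (hI : USC (∏ i, I i) ∨ ∏ i, I i = ⊤) (i : ι) : StableRangeOne (R ⧸ I i) := by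
  have hle : ∏ i, I i ≤ I i := Ideal.prod_le_inf.trans (Finset.inf_le (Finset.mem_univ i))
  rcases hI with h | h
  · exact h.stableRangeOne.of_surjective _ (Ideal.Quotient.factor_surjective hle)
  · have : Subsingleton (R ⧸ I i) :=
      Ideal.Quotient.subsingleton_iff.mpr (eq_top_iff.mpr (h ▸ hle))
    exact fun x y _ => ⟨0, isUnit_of_subsingleton _⟩

end Congruence

end CongruenceRows

theorem mainTheorem2 {R : Type*} [CommRing R] (k : ℕ)
    (I : Fin k ⊕ Fin k → Ideal R)
    (hcomax : ∀ i j, i ≠ j → I i ⊔ I j = ⊤)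
    (hI : CongruenceRows.USC (∏ i, I i) ∨ ∏ i, I i = ⊤)
    (m : Fin k ⊕ Fin k → Fin k ⊕ Fin k → ℕ)
    (Γ : Subgroup (Matrix.symplecticGroup (Fin k) R))
    (hΓ : CongruenceRows.IsCongruenceIdealSubgroup Γ) :
    ((Γ : Set (Matrix.symplecticGroup (Fin k) R)) *
          (CongruenceRows.principalCongruence (Fin k) (∏ i, I i) :
            Set (Matrix.symplecticGroup (Fin k) R)) = Set.univ →
        Function.Surjective (CongruenceRows.rowMap Γ I m)) ∧
      ((∃ J : Ideal R, CongruenceRows.principalCongruence (Fin k) J ≤ Γ ∧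
          J ⊔ ∏ i, I i = ⊤ ∧
          (CongruenceRows.USC ((∏ i, I i) * J) ∨ (∏ i, I i) * J = ⊤)) →
        Function.Surjective (CongruenceRows.rowMap Γ I m)) := by
  have hsr := CongruenceRows.stableRangeOne_of_usc_prod hI
  constructor
  · refine fun hprod => CongruenceRows.rowMap_surjective_of_forall_exists m fun v hv => ?_
    -- With `I' = ⊤` the matrix `A` is only required to have the right rows; its factor `B` in `Γ`
    -- agrees with it modulo every `I i`.
    obtain ⟨A, -, hA⟩ := CongruenceRows.exists_mem_principalCongruence_rows hcomax hsr
      (I' := ⊤) (top_sup_eq _) hv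
    obtain ⟨B, hB, C, hC, rfl⟩ := Set.mem_mul.mp (hprod ▸ Set.mem_univ A)
    refine ⟨B, hB, fun i j => ?_⟩
    have hC' := CongruenceRows.principalCongruence_mono
      (Ideal.prod_le_inf.trans (Finset.inf_le (Finset.mem_univ i))) hC
    have h := (CongruenceRows.symplecticMap_mk_eq_iff (I i) B (B * C)).mp
      (by rw [map_mul, CongruenceRows.mem_principalCongruence.mp hC', mul_one]) i j
    simpa using Ideal.add_mem _ h (hA i j)
  · rintro ⟨J, hJ, hJI, -⟩
    refine CongruenceRows.rowMap_surjective_of_forall_exists m fun v hv => ?_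
    obtain ⟨A, hA, hAv⟩ := CongruenceRows.exists_mem_principalCongruence_rows hcomax hsr hJI hv
    exact ⟨A, hJ hA, hAv⟩
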